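/- An $(a,b)$-module is a free $\mathbb{C}[[b]]$-module $E$ of finite type with a $\mathbb{C}$-linear endomorphism $a$, continuous for the $b$-adic topology, such that $ab-ba=b^2$; its rank is its rank over $\mathbb{C}[[b]]$. Morphisms are the $\mathbb{C}[[b]]$-linear maps commuting with $a$. For $\lambda\in\mathbb{C}$, $E_\lambda=\mathbb{C}[[b]]\,e_\lambda$ is the rank one $(a,b)$-module with $a e_\lambda=\lambda b e_\lambda$. $E$ is regular if its saturation by $b^{-1}a$ in $E[b^{-1}]$ is finitely generated over $\mathbb{C}[[b]]$. Each class $\tilde\mu\in\mathbb{C}/\mathbb{Z}$ is ordered by real parts, and one sets $$\tilde\mu_{\min}(E)=\inf\{\mu\in\tilde\mu : \exists\ \text{a nonzero morphism } E_\mu\to E\},\qquad \tilde\mu_{\max}(E)=\sup\{\mu\in\tilde\mu : \exists\ \text{a nonzero morphism } E\to E_\mu\},$$ $$L_{\tilde\mu}(E)=\tilde\mu_{\max}(E)-\tilde\mu_{\min}(E),\qquad L(E)=\sup_{\tilde\mu\in\mathbb{C}/\mathbb{Z}}L_{\tilde\mu}(E),$$ with $\inf\emptyset=+\infty$, $\sup\emptyset=-\infty$,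 $-\infty-x=-\infty$ for $x\in{]-\infty,+\infty]}$ and $+\infty-x=+\infty$ for $x\in{[-\infty,+\infty[}$ (and $x-(+\infty)=-\infty$ for finite $x$). Let $E$ be a regular $(a,b)$-module. (1) Let $\tilde\lambda\in\mathbb{C}/\mathbb{Z}$ be such that $\lambda=\tilde\lambda_{\min}(E)$ is finite, and let $0\to E_\lambda\to E\to F\to 0$ be an exact sequence of $(a,b)$-modules. Then $L_{\tilde\mu}(F)\le L_{\tilde\mu}(E)+1$ for all $\tilde\mu\in\mathbb{C}/\mathbb{Z}$, and $L(E)+\operatorname{rank}(E)\ge L(F)+\operatorname{rank}(F)$. (2) If $E\neq 0$, then $L(E)+\operatorname{rank}(E)$ is a (finite) integer and is at least $1$. -/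

import Mathlib

open scoped PowerSeries Topology

/-- The `b`-adic topology of a `ℂ⟦b⟧`-module; the variable `b` is `PowerSeries.X`. -/
@[reducible]
noncomputable def bAdicTopology (E : Type*) [AddCommGroup E] [Module ℂ⟦X⟧ E] :
    TopologicalSpace E :=
  (Ideal.span {(PowerSeries.X : ℂ⟦X⟧)}).adicModuleTopology E

/-- An (a,b)-module: a free `ℂ⟦b⟧`-module of finite type with a `ℂ`-linear endomorphism `a`,
continuous for the `b`-adic topology, such that `a b - b a = b ^ 2`. -/
class ABModule (E : Type*) [AddCommGroup E] [Module ℂ E] [Module ℂ⟦X⟧ E]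
    [IsScalarTower ℂ ℂ⟦X⟧ E] : Type _ where
  free : Module.Free ℂ⟦X⟧ E
  finite : Module.Finite ℂ⟦X⟧ E
  a : E →ₗ[ℂ] E
  continuous_a : Continuous[bAdicTopology E, bAdicTopology E] a
  comm_a : ∀ x : E, a ((PowerSeries.X : ℂ⟦X⟧) • x) - (PowerSeries.X : ℂ⟦X⟧) • a x
    = (PowerSeries.X : ℂ⟦X⟧) ^ 2 • x

namespace ABModule

attribute [instance] ABModule.free ABModule.finite

/-- An additive map satisfying the commutation relation is continuous for the `b`-adic topology. -/
theorem continuous_of_comm {E : Type*} [AddCommGroup E] [Module ℂ⟦X⟧ E] (f : E →+ E)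
    (h : ∀ x : E, f ((PowerSeries.X : ℂ⟦X⟧) • x) - (PowerSeries.X : ℂ⟦X⟧) • f x
      = (PowerSeries.X : ℂ⟦X⟧) ^ 2 • x) :
    Continuous[bAdicTopology E, bAdicTopology E] f := by
  have hpow : ∀ (n : ℕ) (x : E), ∃ y : E,
      f ((PowerSeries.X : ℂ⟦X⟧) ^ n • x) = (PowerSeries.X : ℂ⟦X⟧) ^ n • y := by
    intro n
    induction n with
    | zero => intro x; exact ⟨f x, by simp⟩
    | succ n ih =>
      intro x
      obtain ⟨y, hy⟩ := ih x
      refine ⟨y + (PowerSeries.X : ℂ⟦X⟧) • x, ?_⟩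
      have := h ((PowerSeries.X : ℂ⟦X⟧) ^ n • x)
      rw [hy, sub_eq_iff_eq_add] at this
      rw [pow_succ', mul_smul, this, smul_add]
      simp only [← mul_smul]
      rw [add_comm]
      congr 2
      ring
  have hmem : ∀ (n : ℕ) (x : E),
      x ∈ ((Ideal.span {(PowerSeries.X : ℂ⟦X⟧)}) ^ n • (⊤ : Submodule ℂ⟦X⟧ E)) ↔
        ∃ y, (PowerSeries.X : ℂ⟦X⟧) ^ n • y = x := by
    intro n x
    rw [Ideal.span_singleton_pow, Submodule.ideal_span_singleton_smul,
      Submodule.mem_smul_pointwise_iff_exists]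
    simp
  let I : Ideal ℂ⟦X⟧ := Ideal.span {PowerSeries.X}
  let : TopologicalSpace ℂ⟦X⟧ := I.adic_basis.topology
  let B : AddGroupFilterBasis E :=
    (I.ringFilterBasis.moduleFilterBasis (I.adic_module_basis E)).toAddGroupFilterBasis
  let : TopologicalSpace E := B.topology
  have : IsTopologicalAddGroup E := B.isTopologicalAddGroup
  change Continuous f
  refine continuous_of_continuousAt_zero f ?_
  have hb := B.nhds_zero_hasBasis
  rw [ContinuousAt, map_zero]
  refine (hb.tendsto_iff hb).2 ?_
  rintro _ ⟨n, rfl⟩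
  refine ⟨_, ⟨n, rfl⟩, ?_⟩
  intro x hx
  obtain ⟨y, rfl⟩ := (hmem n x).1 hx
  obtain ⟨z, hz⟩ := hpow n y
  exact (hmem n _).2 ⟨z, hz.symm⟩

/-- The (a,b)-module `E_l = ℂ⟦b⟧ e` of rank one with `a e = l b e`; the element `S(b) e` is
represented by the power series `S`. -/
def RankOne (_l : ℂ) : Type := ℂ⟦X⟧

namespace RankOne

noncomputable instance (l : ℂ) : AddCommGroup (RankOne l) :=
  inferInstanceAs (AddCommGroup ℂ⟦X⟧)

noncomputable instance (l : ℂ) : Module ℂ⟦X⟧ (RankOne l) :=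
  inferInstanceAs (Module ℂ⟦X⟧ ℂ⟦X⟧)

noncomputable instance (l : ℂ) : Module ℂ (RankOne l) :=
  inferInstanceAs (Module ℂ ℂ⟦X⟧)

instance (l : ℂ) : IsScalarTower ℂ ℂ⟦X⟧ (RankOne l) :=
  inferInstanceAs (IsScalarTower ℂ ℂ⟦X⟧ ℂ⟦X⟧)

/-- `a (S e) = (l b S + b ^ 2 S') e`. -/
noncomputable def aMap (l : ℂ) : ℂ⟦X⟧ →ₗ[ℂ] ℂ⟦X⟧ where
  toFun S := l • (PowerSeries.X * S) + PowerSeries.X ^ 2 * PowerSeries.derivative ℂ S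
  map_add' S T := by simp only [map_add, mul_add, smul_add]; abel
  map_smul' c S := by
    simp only [Derivation.map_smul, mul_smul_comm, smul_add, RingHom.id_apply, smul_comm c l]

theorem aMap_comm (l : ℂ) (S : ℂ⟦X⟧) :
    aMap l (PowerSeries.X * S) - PowerSeries.X * aMap l S = PowerSeries.X ^ 2 * S := by
  simp only [aMap, LinearMap.coe_mk, AddHom.coe_mk, Derivation.leibniz, PowerSeries.derivative_X,
    smul_eq_mul, PowerSeries.smul_eq_C_mul]
  ring

noncomputable instance (l : ℂ) : ABModule (RankOne l) where
  free := inferInstanceAs (Module.Free ℂ⟦X⟧ ℂ⟦X⟧)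
  finite := inferInstanceAs (Module.Finite ℂ⟦X⟧ ℂ⟦X⟧)
  a := aMap l
  continuous_a := continuous_of_comm (E := ℂ⟦X⟧) (aMap l).toAddMonoidHom (aMap_comm l)
  comm_a := aMap_comm l

end RankOne

section

variable (E : Type*) [AddCommGroup E] [Module ℂ E] [Module ℂ⟦X⟧ E] [IsScalarTower ℂ ℂ⟦X⟧ E]
  [ABModule E]

variable {E} in
/-- The Leibniz rule `a (S x) = S a(x) + b ^ 2 S' x` for `S` a power of `b`. -/
theorem a_smul (s : Submonoid.powers (PowerSeries.X : ℂ⟦X⟧)) (x : E) :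
    a ((s : ℂ⟦X⟧) • x) = (s : ℂ⟦X⟧) • (a x : E)
      + (PowerSeries.X ^ 2 * PowerSeries.derivative ℂ (s : ℂ⟦X⟧)) • x := by
  obtain ⟨_, n, rfl⟩ := s
  induction n with
  | zero => simp
  | succ n ih =>
    have h := comm_a ((PowerSeries.X : ℂ⟦X⟧) ^ n • x)
    simp only at ih ⊢
    rw [ih, sub_eq_iff_eq_add] at h
    rw [pow_succ', mul_smul, h, Derivation.leibniz, PowerSeries.derivative_X]
    simp only [← mul_smul, smul_add, smul_eq_mul, mul_one, add_smul, mul_add]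
    rw [add_comm, add_assoc]
    congr 3
    ring

/-- The identity behind the well-definedness of `bInvA`. -/
theorem quotient_rule {R M : Type*} [CommRing R] [AddCommGroup M] [Module R M]
    {b s t u s' t' u' : R} {x y x' y' : M} (h1 : (u * t) • x = (u * s) • y)
    (h2 : (u * t) • x' + (b ^ 2 * (u * t' + t * u')) • x
      = (u * s) • y' + (b ^ 2 * (u * s' + s * u')) • y) :
    (u * u) • (t * t * b) • (s • x' - (b ^ 2 * s') • x)
      = (u * u) • (s * s * b) • (t • y' - (b ^ 2 * t') • y) := by
  linear_combination (norm := module) (u * s * t * b) • h2 - (b ^ 3 * (u' * s * t + u * s' * t + u * s * t')) • h1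

/-- `E[b⁻¹]`, the localization of `E` at the powers of `b`. -/
abbrev Loc : Type _ := LocalizedModule (Submonoid.powers (PowerSeries.X : ℂ⟦X⟧)) E

/-- The operator `b⁻¹ a` on `E[b⁻¹]`, where `a` is extended to `E[b⁻¹]` by the commutation
relation: `a (s⁻¹ x) = s⁻¹ a(x) - b ^ 2 s' s⁻² x` for `s` a power of `b`. -/
noncomputable def bInvA (z : Loc E) : Loc E :=
  z.liftOn
    (fun p => LocalizedModule.mk
      ((p.2 : ℂ⟦X⟧) • a p.1
        - (PowerSeries.X ^ 2 * PowerSeries.derivative ℂ (p.2 : ℂ⟦X⟧)) • p.1)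
      (p.2 * p.2 * ⟨PowerSeries.X, Submonoid.mem_powers _⟩))
    (by
      rintro ⟨x, s⟩ ⟨y, t⟩ ⟨u, h⟩
      have h1 : ((u * t : Submonoid.powers (PowerSeries.X : ℂ⟦X⟧)) : ℂ⟦X⟧) • x
          = ((u * s : Submonoid.powers (PowerSeries.X : ℂ⟦X⟧)) : ℂ⟦X⟧) • y := by
        simpa only [Submonoid.smul_def, Submonoid.coe_mul, mul_smul] using h
      have h2 := congrArg (fun w : E => (a w : E)) h1
      simp only [a_smul] at h2
      simp only [Submonoid.coe_mul, Derivation.leibniz, smul_eq_mul] at h1 h2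
      refine LocalizedModule.mk_eq.mpr ⟨u * u, ?_⟩
      simp only [Submonoid.smul_def, Submonoid.coe_mul]
      exact quotient_rule h1 h2)

theorem bInvA_mk (x : E) (s : Submonoid.powers (PowerSeries.X : ℂ⟦X⟧)) :
    bInvA E (LocalizedModule.mk x s) = LocalizedModule.mk
      ((s : ℂ⟦X⟧) • a x - (PowerSeries.X ^ 2 * PowerSeries.derivative ℂ (s : ℂ⟦X⟧)) • x)
      (s * s * ⟨PowerSeries.X, Submonoid.mem_powers _⟩) :=
  LocalizedModule.liftOn_mk _ _ _

/-- The saturation of `E` by `b⁻¹ a`: the smallest sub-`ℂ⟦b⟧`-module of `E[b⁻¹]` that contains `E`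
and is stable by `b⁻¹ a`. -/
noncomputable def saturation : Submodule ℂ⟦X⟧ (Loc E) :=
  sInf {N | LinearMap.range
      (LocalizedModule.mkLinearMap (Submonoid.powers (PowerSeries.X : ℂ⟦X⟧)) E) ≤ N ∧
    ∀ z ∈ N, bInvA E z ∈ N}

/-- `E` is regular when its saturation by `b⁻¹ a` is of finite type over `ℂ⟦b⟧`. -/
def IsRegular : Prop := (saturation E).FG

end

/-- Morphisms of (a,b)-modules: the `ℂ⟦b⟧`-linear maps that commute with `a`. -/
def IsMorphism {E F : Type*} [AddCommGroup E] [Module ℂ E] [Module ℂ⟦X⟧ E]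
    [IsScalarTower ℂ ℂ⟦X⟧ E] [ABModule E] [AddCommGroup F] [Module ℂ F] [Module ℂ⟦X⟧ F]
    [IsScalarTower ℂ ℂ⟦X⟧ F] [ABModule F] (f : E →ₗ[ℂ⟦X⟧] F) : Prop :=
  ∀ x, f (a x) = a (f x)

/-- The group `ℂ / ℤ`. -/
abbrev CModZ : Type := ℂ ⧸ AddSubgroup.zmultiples (1 : ℂ)

section

variable (E : Type*) [AddCommGroup E] [Module ℂ E] [Module ℂ⟦X⟧ E] [IsScalarTower ℂ ℂ⟦X⟧ E]
  [ABModule E] (c : CModZ)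

/-- The infimum of the `l` in the class `c` with a non zero morphism `E_l → E`. Since `c` is ordered
by real parts, and an element of `c` is determined by its real part, an element of `c` (or `±∞`) is
recorded as its real part in the extended reals. -/
noncomputable def lambdaMin : EReal :=
  ⨅ l ∈ {l : ℂ | (QuotientAddGroup.mk l : CModZ) = c ∧
    ∃ f : RankOne l →ₗ[ℂ⟦X⟧] E, IsMorphism f ∧ f ≠ 0}, ((l.re : ℝ) : EReal)

/-- The supremum of the `l` in the class `c` with a non zero morphism `E → E_l`, recorded as
in `lambdaMin`. -/
noncomputable def lambdaMax : EReal :=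
  ⨆ l ∈ {l : ℂ | (QuotientAddGroup.mk l : CModZ) = c ∧
    ∃ f : E →ₗ[ℂ⟦X⟧] RankOne l, IsMorphism f ∧ f ≠ 0}, ((l.re : ℝ) : EReal)

/-- The width of `E` in the class `c`; here `-∞ - x = -∞` for every `x`, and `x - (+∞) = -∞`. -/
noncomputable def widthAt : EReal := lambdaMax E c - lambdaMin E c

/-- The width of `E`. -/
noncomputable def width : EReal := ⨆ c : CModZ, widthAt E c

end

end ABModule

/-! A nonzero morphism `E_μ → E` is the same as a nonzero `e` with `a e = μ b e`.

For (1), let `e_l` be the image of the generator of `E_l`. Composing with `E → F` shows that the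
maximum of `F` is at most that of `E`. For the minimum, lift a solution in `F` of exponent `μ` to
`x`, so that `a x = μ b x + S e_l`, and look for a solution `b x + g e_l` of exponent `μ + 1`. The
equation for `g` is solved coefficientwise unless `μ + 1 - l` is a natural number, and in that case
minimality of `l` already gives `l ≤ μ + 1` (`lambdaMin_le_of_exact`). Each width therefore grows by
at most 1, while the rank drops by exactly 1.

For (2), regularity provides a lattice `M` in `E`, containing some `b ^ k E`, on which `θ = b⁻¹ a`
acts (`IsRegular.hasSimplePoleLattice`). The eigenvalues of `θ` on `M / b M` bound the exponents of
morphisms from and to rank one modules, and exponents of one class differ by integers. Hence the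
widths other than `-∞` are integers bounded above. An eigenvalue of least real part lifts to an
eigenvector of `θ` by formal power series, so some `E_l` embeds in `E`. Taking `l` minimal in its
class makes the image saturated, so the quotient is free and (1) applies to it. Induction on the
rank reduces `1 ≤ L + rank` to rank one, where `E ≅ E_l` has nonnegative width. -/

namespace ABModule

/-! ### Separation and completeness of finite modules over power series. -/

section XAdic

variable {K M : Type*} [Field K] [AddCommGroup M] [Module K⟦X⟧ M] [Module.Finite K⟦X⟧ M]

open PowerSeries

/-- A finite `K⟦X⟧`-module is separated for the `X`-adic topology. -/
theorem eq_zero_of_forall_X_pow_smul {x : M}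
    (h : ∀ n : ℕ, ∃ y : M, x = (X : K⟦X⟧) ^ n • y) : x = 0 := by
  have hle : Ideal.span {(X : K⟦X⟧)} ≤ (⊥ : Ideal K⟦X⟧).jacobson := by
    rw [IsLocalRing.jacobson_eq_maximalIdeal _ bot_ne_top, Ideal.span_singleton_le_iff_mem,
      IsLocalRing.mem_maximalIdeal, mem_nonunits_iff]
    exact PowerSeries.X_prime.not_isUnit
  refine (IsHausdorff.of_le_jacobson (Ideal.span {(X : K⟦X⟧)}) M hle).haus x fun n => ?_
  obtain ⟨y, rfl⟩ := h n
  rw [SModEq.zero, Ideal.span_singleton_pow]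
  exact Submodule.smul_mem_smul (Ideal.mem_span_singleton_self _) trivial

/-- In a finite `K⟦X⟧`-module, every series `∑ X ^ j y_j` converges. -/
theorem exists_sum_X_pow_smul (y : ℕ → M) :
    ∃ x : M, ∀ k : ℕ, ∃ z : M,
      x = ∑ j ∈ Finset.range k, (X : K⟦X⟧) ^ j • y j + (X : K⟦X⟧) ^ k • z := by
  obtain ⟨n, π, hπ⟩ := Module.Finite.exists_fin' K⟦X⟧ M
  choose c hc using fun j => hπ (y j)
  -- The terms with `j > m` do not affect the coefficient of index `m`, so each coefficient of the
  -- limit is a finite sum.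
  let s : Fin n → K⟦X⟧ := fun i =>
    PowerSeries.mk fun m => coeff m (∑ j ∈ Finset.range (m + 1), X ^ j * c j i)
  have hs : ∀ (k : ℕ) (i : Fin n),
      (X : K⟦X⟧) ^ k ∣ s i - ∑ j ∈ Finset.range k, X ^ j * c j i := by
    intro k i
    rw [X_pow_dvd_iff]
    intro m hm
    rw [map_sub, coeff_mk, sub_eq_zero, ← Finset.sum_range_add_sum_Ico _ (Nat.succ_le_of_lt hm),
      map_add, left_eq_add, map_sum]
    refine Finset.sum_eq_zero fun j hj => ?_
    rw [coeff_X_pow_mul', if_neg]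
    have := (Finset.mem_Ico.1 hj).1
    omega
  refine ⟨π s, fun k => ?_⟩
  choose t ht using hs k
  refine ⟨π t, ?_⟩
  have : s = ∑ j ∈ Finset.range k, (X : K⟦X⟧) ^ j • c j + (X : K⟦X⟧) ^ k • t := by
    ext1 i
    rw [Pi.add_apply, Finset.sum_apply, Pi.smul_apply, smul_eq_mul, ← ht i]
    simp
  rw [this, map_add, map_sum, map_smul]
  simp only [map_smul, hc]

/-- A nonzero vector is a power of `X` times a vector that is not divisible by `X`. -/
theorem exists_eq_X_pow_smul {x : M} (hx : x ≠ 0) :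
    ∃ (m : ℕ) (y : M), x = (X : K⟦X⟧) ^ m • y ∧ ∀ z : M, y ≠ (X : K⟦X⟧) • z := by
  classical
  have h : ∃ n : ℕ, ∀ y : M, x ≠ (X : K⟦X⟧) ^ n • y := by
    by_contra! h
    exact hx (eq_zero_of_forall_X_pow_smul h)
  obtain ⟨m, hm⟩ : ∃ m, Nat.find h = m + 1 := by
    refine Nat.exists_eq_succ_of_ne_zero fun h0 => ?_
    have := Nat.find_spec h
    rw [h0] at this
    exact this x (by simp)
  have hlt := Nat.find_min h (m := m) (by omega)
  push Not at hlt
  obtain ⟨y, hy⟩ := hlt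
  refine ⟨m, y, hy, ?_⟩
  rintro z rfl
  have := Nat.find_spec h z
  rw [hm, pow_succ, mul_smul] at this
  exact this hy

end XAdic

/-! ### Operators `θ` with `θ b = b θ + b`: eigenvalues modulo `b`, formal eigenvectors. -/

section SimplePole

open PowerSeries

variable {M : Type*} [AddCommGroup M] [Module ℂ M] [Module ℂ⟦X⟧ M]

theorem theta_X_pow_smul {θ : M →ₗ[ℂ] M}
    (hθ : ∀ x, θ ((X : ℂ⟦X⟧) • x) = (X : ℂ⟦X⟧) • θ x + (X : ℂ⟦X⟧) • x) (k : ℕ) (x : M) :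
    θ ((X : ℂ⟦X⟧) ^ k • x) = (X : ℂ⟦X⟧) ^ k • (θ x + (k : ℂ) • x) := by
  induction k with
  | zero => simp
  | succ k ih =>
    rw [pow_succ', mul_smul, hθ, ih, ← smul_add, ← smul_add, add_assoc, mul_smul]
    push_cast
    rw [add_smul, one_smul]

variable [IsScalarTower ℂ ℂ⟦X⟧ M]

theorem smul_comm_complex (c : ℂ) (S : ℂ⟦X⟧) (x : M) : S • c • x = c • S • x := by
  rw [← smul_one_smul ℂ⟦X⟧ c x, ← smul_one_smul ℂ⟦X⟧ c (S • x), smul_smul, smul_smul, mul_comm]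

theorem C_smul (c : ℂ) (x : M) : (C c : ℂ⟦X⟧) • x = c • x := by
  rw [← smul_one_smul ℂ⟦X⟧ c x, smul_eq_C_mul, mul_one]

variable [Module.Finite ℂ⟦X⟧ M]

/-- The eigenvalues of the endomorphism that `θ` induces on `M / X M`. -/
theorem exists_indicial_finset (θ : M →ₗ[ℂ] M)
    (hθ : ∀ x, θ ((X : ℂ⟦X⟧) • x) = (X : ℂ⟦X⟧) • θ x + (X : ℂ⟦X⟧) • x) :
    ∃ σ : Finset ℂ, (Nontrivial M → σ.Nonempty) ∧
      (∀ μ ∈ σ, ∃ y w : M, (∀ z : M, y ≠ (X : ℂ⟦X⟧) • z) ∧ θ y = μ • y + (X : ℂ⟦X⟧) • w) ∧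
      ∀ μ ∉ σ, (∀ x : M, ∃ y z : M, x = θ y - μ • y + (X : ℂ⟦X⟧) • z) ∧
        ∀ y w : M, θ y = μ • y + (X : ℂ⟦X⟧) • w → ∃ z : M, y = (X : ℂ⟦X⟧) • z := by
  classical
  let m : M →ₗ[ℂ] M :=
    { toFun := fun x => (X : ℂ⟦X⟧) • x
      map_add' := smul_add _
      map_smul' := fun c x => smul_comm_complex c _ x }
  have hm : ∀ x, m x = (X : ℂ⟦X⟧) • x := fun _ => rfl
  let N : Submodule ℂ M := LinearMap.range m
  have hN : ∀ x : M, (Submodule.Quotient.mk x : M ⧸ N) = 0 ↔ ∃ z, x = (X : ℂ⟦X⟧) • z := by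
    intro x
    rw [Submodule.Quotient.mk_eq_zero, LinearMap.mem_range]
    exact exists_congr fun z => eq_comm
  have : FiniteDimensional ℂ (M ⧸ N) := by
    obtain ⟨n, π, hπ⟩ := Module.Finite.exists_fin' ℂ⟦X⟧ M
    -- Modulo `X` only the constant terms of the coordinates matter, so `ℂ ^ n` maps onto `M / X M`.
    let g : (Fin n → ℂ) →ₗ[ℂ] M :=
      { toFun := fun c => π fun i => C (c i)
        map_add' := fun c d => by
          rw [← map_add]; congr 1; ext1 i; simp
        map_smul' := fun r c => by
          rw [RingHom.id_apply, ← C_smul r (π _), ← map_smul]; congr 1; ext1 i; simp }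
    refine Module.Finite.of_surjective (N.mkQ ∘ₗ g) fun v => ?_
    obtain ⟨x, rfl⟩ := N.mkQ_surjective v
    obtain ⟨s, rfl⟩ := hπ x
    refine ⟨fun i => constantCoeff (s i), ?_⟩
    rw [LinearMap.comp_apply, ← sub_eq_zero, ← map_sub, Submodule.mkQ_apply, hN]
    refine ⟨π fun i => - PowerSeries.mk fun p => coeff (p + 1) (s i), ?_⟩
    rw [← map_smul]
    change π _ - π _ = _
    rw [← map_sub]
    congr 1
    ext1 i
    rw [Pi.sub_apply, Pi.smul_apply, smul_eq_mul, mul_neg, ← sub_const_eq_X_mul_shift, neg_sub]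
  have hNθ : N ≤ N.comap θ := by
    rintro _ ⟨z, rfl⟩
    exact ⟨θ z + z, by rw [hm, hm, hθ, smul_add]⟩
  let T : Module.End ℂ (M ⧸ N) := N.mapQ N θ hNθ
  have hT : ∀ x : M, T (Submodule.Quotient.mk x) = Submodule.Quotient.mk (θ x) :=
    fun x => Submodule.mapQ_apply _ _ _ _
  have hker : ∀ μ (x : M), (T - algebraMap ℂ _ μ) (Submodule.Quotient.mk x) =
      (Submodule.Quotient.mk (θ x - μ • x) : M ⧸ N) := by
    intro μ x
    rw [LinearMap.sub_apply, hT, Module.algebraMap_end_apply]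
    rfl
  refine ⟨(T.finite_hasEigenvalue).toFinset, ?_, ?_, ?_⟩
  · intro hM
    have : Nontrivial (M ⧸ N) := by
      obtain ⟨x, hx⟩ := exists_ne (0 : M)
      obtain ⟨-, y, -, hy⟩ := exists_eq_X_pow_smul (K := ℂ) hx
      refine ⟨⟨Submodule.Quotient.mk y, 0, fun h => ?_⟩⟩
      obtain ⟨z, hz⟩ := (hN y).1 h
      exact hy z hz
    obtain ⟨μ, hμ⟩ := Module.End.exists_eigenvalue T
    exact ⟨μ, by simpa using hμ⟩
  · intro μ hμ
    rw [Set.Finite.mem_toFinset] at hμ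
    obtain ⟨v, hv, hv0⟩ := Module.End.HasEigenvalue.exists_hasEigenvector hμ
    obtain ⟨y, rfl⟩ := Submodule.Quotient.mk_surjective _ v
    have h : (Submodule.Quotient.mk (θ y - μ • y) : M ⧸ N) = 0 := by
      rw [← hker, LinearMap.sub_apply, Module.End.mem_eigenspace_iff.1 hv,
        Module.algebraMap_end_apply, sub_self]
    obtain ⟨w, hw⟩ := (hN _).1 h
    refine ⟨y, w, fun z hz => hv0 ((hN y).2 ⟨z, hz⟩), ?_⟩
    rw [← hw]; abel
  · intro μ hμ
    rw [Set.Finite.mem_toFinset] at hμ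
    have hinj : Function.Injective (T - algebraMap ℂ (Module.End ℂ (M ⧸ N)) μ) := by
      rw [← LinearMap.ker_eq_bot]
      by_contra h
      refine hμ ?_
      rwa [Algebra.algebraMap_eq_smul_one, ← Module.End.eigenspace_def] at h
    refine ⟨fun x => ?_, fun y w hy => ?_⟩
    · obtain ⟨v, hv⟩ := LinearMap.injective_iff_surjective.1 hinj (Submodule.Quotient.mk x)
      obtain ⟨y, rfl⟩ := Submodule.Quotient.mk_surjective _ v
      rw [hker, eq_comm, ← sub_eq_zero, ← Submodule.Quotient.mk_sub, hN] at hv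
      obtain ⟨z, hz⟩ := hv
      exact ⟨y, z, by rw [← hz]; abel⟩
    · rw [← hN]
      refine hinj ?_
      rw [hker, map_zero, hN]
      exact ⟨w, by rw [hy]; abel⟩

/-- A simple pole operator on a nonzero module has an eigenvector. -/
theorem exists_eigenvector [Nontrivial M] (θ : M →ₗ[ℂ] M)
    (hθ : ∀ x, θ ((X : ℂ⟦X⟧) • x) = (X : ℂ⟦X⟧) • θ x + (X : ℂ⟦X⟧) • x) :
    ∃ (μ : ℂ) (x : M), x ≠ 0 ∧ θ x = μ • x := by
  obtain ⟨σ, hne, heig, hreg⟩ := exists_indicial_finset θ hθ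
  obtain ⟨μ, hμσ, hμ⟩ := σ.exists_min_image Complex.re (hne ‹_›)
  obtain ⟨y₀, w₀, hy₀, hw₀⟩ := heig μ hμσ
  -- As `μ` has least real part in `σ`, `μ - (k + 1)` is not in `σ`, so `θ + (k + 1) - μ` is onto
  -- modulo `X`: the next term can cancel any remainder `r` up to a multiple of `X`.
  have hsolve : ∀ (k : ℕ) (r : M), ∃ y z : M,
      (X : ℂ⟦X⟧) • z = r + (θ y + ((k + 1 : ℕ) : ℂ) • y - μ • y) := by
    intro k r
    obtain ⟨y, z, h⟩ := (hreg (μ - (k + 1 : ℕ)) (fun h => by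
      have := hμ _ h
      rw [Complex.sub_re, Complex.natCast_re] at this
      push_cast at this
      linarith [(Nat.cast_nonneg k : (0 : ℝ) ≤ k)])).1 (-r)
    refine ⟨y, -z, ?_⟩
    rw [neg_eq_iff_eq_neg.1 h, sub_smul, smul_neg]
    abel
  choose Y Z hYZ using hsolve
  -- `R k` is the error left after the terms `y 0, …, y k`, divided by `X ^ (k + 1)`.
  let R : ℕ → M := fun k => Nat.rec w₀ Z k
  let y : ℕ → M := fun k => Nat.casesOn k y₀ fun j => Y j (R j)
  have hpart : ∀ k : ℕ, θ (∑ j ∈ Finset.range (k + 1), (X : ℂ⟦X⟧) ^ j • y j)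
      = μ • (∑ j ∈ Finset.range (k + 1), (X : ℂ⟦X⟧) ^ j • y j)
        + (X : ℂ⟦X⟧) ^ (k + 1) • R k := by
    intro k
    induction k with
    | zero => simpa [y, R] using hw₀
    | succ k ih =>
      have hR : (X : ℂ⟦X⟧) • R (k + 1) = _ := hYZ k (R k)
      have hy : y (k + 1) = Y k (R k) := rfl
      rw [Finset.sum_range_succ, map_add, ih, theta_X_pow_smul hθ, pow_succ _ (k + 1),
        mul_smul, hR, hy]
      simp only [smul_add, smul_sub, smul_comm_complex]
      abel
  obtain ⟨x, hx⟩ := exists_sum_X_pow_smul (K := ℂ) y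
  refine ⟨μ, x, ?_, ?_⟩
  · rintro rfl
    obtain ⟨z, hz⟩ := hx 1
    refine hy₀ (-z) ?_
    have : y 0 = y₀ := rfl
    simp only [Finset.range_one, Finset.sum_singleton, pow_zero, one_smul, pow_one, this] at hz
    rw [smul_neg]
    exact eq_neg_of_add_eq_zero_left hz.symm
  · rw [← sub_eq_zero]
    refine eq_zero_of_forall_X_pow_smul (K := ℂ) fun n => ?_
    obtain ⟨z, hz⟩ := hx (n + 1)
    refine ⟨(X : ℂ⟦X⟧) • (R n + (θ z + ((n + 1 : ℕ) : ℂ) • z) - μ • z), ?_⟩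
    rw [hz, map_add, hpart, theta_X_pow_smul hθ, ← mul_smul, ← pow_succ]
    simp only [smul_add, smul_sub, smul_comm_complex]
    abel

end SimplePole

/-! ### Rank one modules, lifting of eigenvectors, and the inequalities of (1). -/

section Basic

open PowerSeries

set_option linter.unusedSectionVars false

section Identities

variable {R M : Type*} [CommRing R] [AddCommGroup M] [Module R M]

theorem leibniz_defect_identity (b S S' : R) (u v x : M) :
    b • u + b ^ 2 • S • x - (b * S) • v - (b ^ 2 * (b * S' + S * 1)) • x
      = b • (u - S • v - (b ^ 2 * S') • x) := by
  module

theorem lift_eigenvector_identity {b g g' S l m : R} (x e : M)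
    (h : S + l * g + b * g' = (m + 1) * g) :
    b • (S • e + m • b • x) + b ^ 2 • x + (g • l • b • e + (b ^ 2 * g') • e)
      = (m + 1) • b • (b • x + g • e) := by
  linear_combination (norm := module) b • congrArg (fun s => s • e) h

end Identities

variable {E F : Type*} [AddCommGroup E] [Module ℂ E] [Module ℂ⟦X⟧ E] [IsScalarTower ℂ ℂ⟦X⟧ E]
  [ABModule E] [AddCommGroup F] [Module ℂ F] [Module ℂ⟦X⟧ F] [IsScalarTower ℂ ℂ⟦X⟧ F]
  [ABModule F]

theorem X_pow_smul_cancel (k : ℕ) {x y : E} (h : (X : ℂ⟦X⟧) ^ k • x = (X : ℂ⟦X⟧) ^ k • y) :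
    x = y :=
  smul_right_injective E (pow_ne_zero k X_ne_zero) h

theorem X_smul_cancel {x y : E} (h : (X : ℂ⟦X⟧) • x = (X : ℂ⟦X⟧) • y) : x = y :=
  smul_right_injective E X_ne_zero h

theorem X_smul_ne_zero {x : E} (h : x ≠ 0) : (X : ℂ⟦X⟧) • x ≠ 0 :=
  smul_ne_zero X_ne_zero h

theorem a_X_smul (x : E) : a ((X : ℂ⟦X⟧) • x) = (X : ℂ⟦X⟧) • a x + (X : ℂ⟦X⟧) ^ 2 • x :=
  sub_eq_iff_eq_add'.1 (comm_a x)

theorem a_X_pow_smul (k : ℕ) (x : E) : a ((X : ℂ⟦X⟧) ^ k • x)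
    = (X : ℂ⟦X⟧) ^ k • (a x + (k : ℂ) • (X : ℂ⟦X⟧) • x) := by
  induction k with
  | zero => simp
  | succ k ih =>
    rw [pow_succ', mul_smul, a_X_smul, ih]
    push_cast
    simp only [smul_add, add_smul, one_smul, mul_smul, smul_comm_complex, pow_two]
    rw [add_assoc, ← mul_smul _ X, ← pow_succ, pow_succ', mul_smul]

/-- The Leibniz rule for the multiplication by a power series. -/
theorem a_series_smul (S : ℂ⟦X⟧) (x : E) :
    a (S • x) = S • (a x : E) + (X ^ 2 * derivative ℂ S) • x := by
  -- The defect in the Leibniz rule is additive in `S`, commutes with multiplication by `X` and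
  -- vanishes on constants. It is thus divisible by every power of `X`.
  have hX : ∀ S : ℂ⟦X⟧, a ((X * S) • x) - (X * S) • (a x : E)
      - (X ^ 2 * derivative ℂ (X * S)) • x
      = (X : ℂ⟦X⟧) • (a (S • x) - S • (a x : E) - (X ^ 2 * derivative ℂ S) • x) := by
    intro S
    rw [mul_smul X S x, a_X_smul, Derivation.leibniz, derivative_X, smul_eq_mul, smul_eq_mul]
    exact leibniz_defect_identity _ _ _ _ _ _
  have key : ∀ (n : ℕ) (S : ℂ⟦X⟧), ∃ y : E,
      a (S • x) - S • (a x : E) - (X ^ 2 * derivative ℂ S) • x = (X : ℂ⟦X⟧) ^ n • y := by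
    intro n
    induction n with
    | zero => exact fun S => ⟨_, by rw [pow_zero, one_smul]⟩
    | succ n ih =>
      intro S
      obtain ⟨T, c, rfl⟩ : ∃ (T : ℂ⟦X⟧) (c : ℂ), S = X * T + C c :=
        ⟨_, _, eq_X_mul_shift_add_const S⟩
      obtain ⟨y, hy⟩ := ih T
      refine ⟨y, ?_⟩
      rw [pow_succ' X n, mul_smul X, ← hy, ← hX, add_smul, map_add, map_add, C_smul,
        (a : E →ₗ[ℂ] E).map_smul, derivative_C, add_zero, add_smul, C_smul]
      abel
  rw [← sub_eq_zero, ← sub_sub]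
  exact eq_zero_of_forall_X_pow_smul (K := ℂ) fun n => key n S

/-- The generator of `E_l`. -/
noncomputable def RankOne.gen (l : ℂ) : RankOne l := (1 : ℂ⟦X⟧)

theorem RankOne.a_gen (l : ℂ) : a (RankOne.gen l) = l • (X : ℂ⟦X⟧) • RankOne.gen l := by
  change RankOne.aMap l 1 = l • (X * 1 : ℂ⟦X⟧)
  change l • (X * 1) + X ^ 2 * derivative ℂ (1 : ℂ⟦X⟧) = _
  rw [Derivation.map_one_eq_zero, mul_zero, add_zero]

theorem RankOne.eq_smul_gen {l : ℂ} (S : RankOne l) : S = (show ℂ⟦X⟧ from S) • RankOne.gen l :=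
  (mul_one (show ℂ⟦X⟧ from S)).symm

/-- A solution `e ∈ E` of `a e = l b e` defines a morphism `E_l → E`. -/
theorem exists_morphism_of_eigenvector {l : ℂ} {e : E} (h : a e = l • (X : ℂ⟦X⟧) • e) :
    ∃ f : RankOne l →ₗ[ℂ⟦X⟧] E, IsMorphism f ∧ ∀ S : ℂ⟦X⟧, f (S • RankOne.gen l) = S • e := by
  let f : RankOne l →ₗ[ℂ⟦X⟧] E := LinearMap.toSpanSingleton ℂ⟦X⟧ E e
  have hf : ∀ S : ℂ⟦X⟧, f (S • RankOne.gen l) = S • e := fun S => by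
    rw [map_smul]
    congr 1
    exact one_smul _ _
  refine ⟨f, fun S => ?_, hf⟩
  rw [RankOne.eq_smul_gen S, a_series_smul, RankOne.a_gen, hf, a_series_smul, h, map_add, hf,
    smul_comm_complex, smul_comm_complex, LinearMap.map_smul_of_tower, ← mul_smul, hf, mul_smul]

theorem IsMorphism.a_gen {l : ℂ} {f : RankOne l →ₗ[ℂ⟦X⟧] E} (hf : IsMorphism f) :
    a (f (RankOne.gen l)) = l • (X : ℂ⟦X⟧) • f (RankOne.gen l) := by
  rw [← hf, RankOne.a_gen, LinearMap.map_smul_of_tower, map_smul]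

theorem gen_ne_zero_of_ne_zero {l : ℂ} {f : RankOne l →ₗ[ℂ⟦X⟧] E} (hf : f ≠ 0) :
    f (RankOne.gen l) ≠ 0 := by
  refine fun h => hf (LinearMap.ext fun S => ?_)
  rw [RankOne.eq_smul_gen S, map_smul, h, smul_zero, LinearMap.zero_apply]

theorem injective_of_ne_zero {l : ℂ} {f : RankOne l →ₗ[ℂ⟦X⟧] E} (hf : f ≠ 0) :
    Function.Injective f := by
  rw [injective_iff_map_eq_zero]
  intro S h
  rw [RankOne.eq_smul_gen S, map_smul] at h
  rw [RankOne.eq_smul_gen S, (smul_eq_zero.1 h).resolve_right (gen_ne_zero_of_ne_zero hf),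
    zero_smul]

variable (E) in
/-- The `l` in the class `c` with a nonzero morphism `E_l → E`. -/
def minSet (c : CModZ) : Set ℂ :=
  {l : ℂ | (QuotientAddGroup.mk l : CModZ) = c ∧ ∃ e : E, e ≠ 0 ∧ a e = l • (X : ℂ⟦X⟧) • e}

variable (E) in
/-- The `l` in the class `c` with a nonzero morphism `E → E_l`. -/
def maxSet (c : CModZ) : Set ℂ :=
  {l : ℂ | (QuotientAddGroup.mk l : CModZ) = c ∧
    ∃ f : E →ₗ[ℂ⟦X⟧] RankOne l, IsMorphism f ∧ f ≠ 0}

theorem exists_morphism_iff {l : ℂ} :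
    (∃ f : RankOne l →ₗ[ℂ⟦X⟧] E, IsMorphism f ∧ f ≠ 0) ↔
      ∃ e : E, e ≠ 0 ∧ a e = l • (X : ℂ⟦X⟧) • e := by
  constructor
  · rintro ⟨f, hf, h0⟩
    exact ⟨_, gen_ne_zero_of_ne_zero h0, hf.a_gen⟩
  · rintro ⟨e, h0, he⟩
    obtain ⟨f, hf, hS⟩ := exists_morphism_of_eigenvector he
    refine ⟨f, hf, ?_⟩
    rintro rfl
    exact h0 (by simpa using (hS 1).symm)

theorem lambdaMin_eq (c : CModZ) : lambdaMin E c = ⨅ l ∈ minSet E c, ((l.re : ℝ) : EReal) := by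
  simp only [lambdaMin, minSet, exists_morphism_iff]

theorem lambdaMax_eq (c : CModZ) : lambdaMax E c = ⨆ l ∈ maxSet E c, ((l.re : ℝ) : EReal) := rfl

theorem lambdaMax_le_of_surjective {p : E →ₗ[ℂ⟦X⟧] F} (hp : IsMorphism p)
    (hs : Function.Surjective p) (c : CModZ) : lambdaMax F c ≤ lambdaMax E c := by
  refine iSup₂_le fun l ⟨hl, f, hf, h0⟩ => ?_
  refine le_iSup₂_of_le (f := fun (l : ℂ) _ => ((l.re : ℝ) : EReal)) l
    ⟨hl, f ∘ₗ p, fun x => ?_, fun h => h0 ?_⟩ le_rfl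
  · rw [LinearMap.comp_apply, hp, hf, LinearMap.comp_apply]
  · exact (LinearMap.cancel_right hs).1 (h.trans (LinearMap.zero_comp p).symm)

/-- Lifting an eigenvector through an extension by `E_l`, up to a shift by one. -/
theorem exists_lift_eigenvector {l μ : ℂ} {i : RankOne l →ₗ[ℂ⟦X⟧] E} {p : E →ₗ[ℂ⟦X⟧] F}
    (hi : IsMorphism i) (hp : IsMorphism p) (hex : Function.Exact i p)
    (hs : Function.Surjective p) {f : F} (h0 : f ≠ 0) (hf : a f = μ • (X : ℂ⟦X⟧) • f)
    (hμ : ∀ n : ℕ, μ + 1 - l - n ≠ 0) :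
    ∃ e : E, e ≠ 0 ∧ a e = (μ + 1) • (X : ℂ⟦X⟧) • e := by
  obtain ⟨x, rfl⟩ := hs f
  obtain ⟨S, hS⟩ := (hex (a x - μ • (X : ℂ⟦X⟧) • x)).1 (by
    rw [map_sub, hp, hf, LinearMap.map_smul_of_tower, map_smul, sub_self])
  -- `b x + g e_l` has exponent `μ + 1` as soon as `S + l g + b g' = (μ + 1) g`; this is that
  -- equation read on coefficients.
  set g : ℂ⟦X⟧ := PowerSeries.mk fun n => coeff n (show ℂ⟦X⟧ from S) / (μ + 1 - l - n) with hg
  have hgS : (show ℂ⟦X⟧ from S) + C l * g + X * derivative ℂ g = C (μ + 1) * g := by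
    ext n
    rw [map_add, map_add, coeff_C_mul, coeff_C_mul]
    have hX : coeff n (X * derivative ℂ g) = n * coeff n g := by
      cases n with
      | zero => simp
      | succ n => rw [coeff_succ_X_mul, coeff_derivative]; push_cast; ring
    rw [hX, hg, coeff_mk]
    field_simp [hμ n]
    ring
  refine ⟨(X : ℂ⟦X⟧) • x + g • i (RankOne.gen l), fun h => X_smul_ne_zero h0 ?_, ?_⟩
  · have := congrArg p h
    rwa [map_add, map_smul, map_smul, hex.apply_apply_eq_zero, smul_zero, add_zero,
      map_zero] at this
  · rw [RankOne.eq_smul_gen S, map_smul, eq_sub_iff_add_eq] at hS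
    rw [map_add, map_one] at hgS
    rw [map_add, a_X_smul, a_series_smul, hi.a_gen, ← hS, ← C_smul μ, ← C_smul l, ← C_smul (μ + 1),
      map_add C, map_one]
    exact lift_eigenvector_identity _ _ hgS

/-- An exponent `μ` of `F` either lifts to the exponent `μ + 1` of `E`, or is resonant with `l`.
Resonance means `μ = l + n - 1` with `n ≥ 0`; then `c` is the class of `l`, whose minimum in `E` is
`l ≤ μ + 1`. -/
theorem lambdaMin_le_of_exact {l : ℂ}
    (hl : ((l.re : ℝ) : EReal) = lambdaMin E (QuotientAddGroup.mk l : CModZ))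
    {i : RankOne l →ₗ[ℂ⟦X⟧] E} {p : E →ₗ[ℂ⟦X⟧] F}
    (hi : IsMorphism i) (hp : IsMorphism p) (hex : Function.Exact i p)
    (hs : Function.Surjective p) (c : CModZ) : lambdaMin E c - 1 ≤ lambdaMin F c := by
  rw [lambdaMin_eq (E := F)]
  refine le_iInf₂ fun μ ⟨hμ, f, h0, hf⟩ => ?_
  rw [EReal.sub_le_iff_le_add (by simp) (by simp)]
  by_cases h : ∀ n : ℕ, μ + 1 - l - n ≠ 0
  · obtain ⟨e, he0, he⟩ := exists_lift_eigenvector hi hp hex hs h0 hf h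
    rw [lambdaMin_eq]
    refine iInf₂_le_of_le (μ + 1) ⟨?_, e, he0, he⟩ (by simp)
    rw [← hμ, QuotientAddGroup.eq]
    exact ⟨-1, by simp⟩
  · push Not at h
    obtain ⟨n, hn⟩ := h
    have hμl : μ = l + (n - 1) := by linear_combination hn
    have hc : (QuotientAddGroup.mk l : CModZ) = c := by
      rw [← hμ, QuotientAddGroup.eq]
      exact ⟨n - 1, by simp [hμl]⟩
    rw [← hc, ← hl, hμl]
    norm_cast
    simp [sub_add_cancel, add_assoc]

theorem widthAt_le_of_exact {l : ℂ}
    (hl : ((l.re : ℝ) : EReal) = lambdaMin E (QuotientAddGroup.mk l : CModZ))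
    {i : RankOne l →ₗ[ℂ⟦X⟧] E} {p : E →ₗ[ℂ⟦X⟧] F}
    (hi : IsMorphism i) (hp : IsMorphism p) (hex : Function.Exact i p)
    (hs : Function.Surjective p) (c : CModZ) : widthAt F c ≤ widthAt E c + 1 := by
  refine (EReal.sub_le_sub (lambdaMax_le_of_surjective hp hs c)
    (lambdaMin_le_of_exact hl hi hp hex hs c)).trans_eq ?_
  -- Regrouping is legitimate even when the extrema are infinite, because 1 is finite.
  rw [widthAt, sub_eq_add_neg, EReal.neg_sub (y := 1) (.inr (EReal.coe_ne_bot 1))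
      (.inr (EReal.coe_ne_top 1)),
    sub_eq_add_neg, add_assoc]

theorem finrank_eq_of_exact {G : Type*} [AddCommGroup G] [Module ℂ⟦X⟧ G] {l : ℂ}
    {i : RankOne l →ₗ[ℂ⟦X⟧] E} {p : E →ₗ[ℂ⟦X⟧] G}
    (hinj : Function.Injective i) (hex : Function.Exact i p) (hs : Function.Surjective p) :
    Module.finrank ℂ⟦X⟧ E = Module.finrank ℂ⟦X⟧ G + 1 := by
  have h1 : Module.finrank ℂ⟦X⟧ (RankOne l) = 1 := Module.finrank_self ℂ⟦X⟧
  rw [← (LinearMap.ker p).finrank_quotient_add_finrank,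
    (p.quotKerEquivOfSurjective hs).finrank_eq, hex.linearMap_ker_eq,
    LinearMap.finrank_range_of_inj hinj, h1]

theorem width_add_finrank_le_of_exact {l : ℂ}
    (hl : ((l.re : ℝ) : EReal) = lambdaMin E (QuotientAddGroup.mk l : CModZ))
    {i : RankOne l →ₗ[ℂ⟦X⟧] E} {p : E →ₗ[ℂ⟦X⟧] F}
    (hi : IsMorphism i) (hp : IsMorphism p) (hinj : Function.Injective i)
    (hex : Function.Exact i p) (hs : Function.Surjective p) :
    width F + (Module.finrank ℂ⟦X⟧ F : EReal) ≤ width E + (Module.finrank ℂ⟦X⟧ E : EReal) := by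
  rw [finrank_eq_of_exact hinj hex hs, Nat.cast_add, Nat.cast_one, add_comm (_ : EReal) 1,
    ← add_assoc]
  gcongr
  exact iSup_le fun c => (widthAt_le_of_exact hl hi hp hex hs c).trans
    (add_le_add_left (le_iSup (widthAt E) c) 1)

end Basic

/-! ### From regularity to a simple pole lattice, and bounds on exponents. -/

section Lattice

open PowerSeries

set_option linter.unusedSectionVars false

variable {E F : Type*} [AddCommGroup E] [Module ℂ E] [Module ℂ⟦X⟧ E] [IsScalarTower ℂ ℂ⟦X⟧ E]
  [ABModule E] [AddCommGroup F] [Module ℂ F] [Module ℂ⟦X⟧ F] [IsScalarTower ℂ ℂ⟦X⟧ F]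
  [ABModule F]

theorem localizedModule_mk_add_mk {R M : Type*} [CommRing R] [AddCommGroup M] [Module R M]
    {S : Submonoid R} (x y : M) (s : S) :
    LocalizedModule.mk x s + LocalizedModule.mk y s = LocalizedModule.mk (x + y) s := by
  rw [LocalizedModule.mk_add_mk, ← smul_add, LocalizedModule.mk_cancel_common_left]

theorem bInvA_identity {R M : Type*} [CommRing R] [AddCommGroup M] [Module R M]
    (b s s' : R) (x y : M) :
    s • (b • y + b ^ 2 • x) - (b ^ 2 * s') • b • x
      = b • (s • y - (b ^ 2 * s') • x + (s * b) • x) := by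
  module

theorem bInvA_X_smul (z : Loc E) :
    bInvA E ((X : ℂ⟦X⟧) • z) = (X : ℂ⟦X⟧) • (bInvA E z + z) := by
  induction z using LocalizedModule.induction_on with
  | _ x s =>
    let t : Submonoid.powers (X : ℂ⟦X⟧) := ⟨X, Submonoid.mem_powers _⟩
    have h : (LocalizedModule.mk x s : Loc E) = LocalizedModule.mk ((s * t) • x) (s * s * t) := by
      rw [mul_assoc, LocalizedModule.mk_cancel_common_right]
    rw [Submonoid.smul_def, Submonoid.coe_mul] at h
    rw [LocalizedModule.smul'_mk, bInvA_mk, bInvA_mk, h, localizedModule_mk_add_mk,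
      LocalizedModule.smul'_mk, a_X_smul, bInvA_identity]

theorem bInvA_X_pow_smul (k : ℕ) (z : Loc E) :
    bInvA E ((X : ℂ⟦X⟧) ^ k • z) = (X : ℂ⟦X⟧) ^ k • (bInvA E z + k • z) := by
  induction k with
  | zero => simp
  | succ k ih =>
    rw [pow_succ', mul_smul, bInvA_X_smul, ih, ← smul_add, add_assoc, ← mul_smul, succ_nsmul]

theorem mk_one_injective :
    Function.Injective fun x : E =>
      (LocalizedModule.mk x 1 : Loc E) := by
  intro x y h
  obtain ⟨⟨_, n, rfl⟩, hu⟩ := LocalizedModule.mk_eq.1 h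
  rw [one_smul, one_smul] at hu
  exact X_pow_smul_cancel n hu

theorem bInvA_mk_one (x : E) :
    (X : ℂ⟦X⟧) • bInvA E (LocalizedModule.mk x 1) = LocalizedModule.mk (a x) 1 := by
  rw [bInvA_mk, LocalizedModule.smul'_mk]
  have h := LocalizedModule.mk_cancel
    (⟨X, Submonoid.mem_powers _⟩ : Submonoid.powers (X : ℂ⟦X⟧)) (a x)
  rw [← h, OneMemClass.coe_one, Derivation.map_one_eq_zero, mul_zero, zero_smul, sub_zero,
    one_smul, one_mul, one_mul]
  rfl

theorem saturation_contains (x : E) : LocalizedModule.mk x 1 ∈ saturation E := by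
  rw [saturation, Submodule.mem_sInf]
  exact fun N hN => hN.1 ⟨x, rfl⟩

theorem saturation_stable {z : Loc E} (hz : z ∈ saturation E) : bInvA E z ∈ saturation E := by
  rw [saturation, Submodule.mem_sInf] at hz ⊢
  exact fun N hN => hN.2 z (hz N hN)

variable (E) in
/-- `E` contains a lattice `M ⊇ b ^ k E` with `a M ⊆ b M`. -/
def HasSimplePoleLattice : Prop :=
  ∃ (M : Submodule ℂ⟦X⟧ E) (k : ℕ), (∀ x : E, (X : ℂ⟦X⟧) ^ k • x ∈ M) ∧
    ∀ x ∈ M, ∃ y ∈ M, a x = (X : ℂ⟦X⟧) • y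

/-- A common denominator `b ^ k` of finitely many generators carries the saturation into `E`. The
lattice is `b ^ k` times the saturation. -/
theorem IsRegular.hasSimplePoleLattice (hE : IsRegular E) : HasSimplePoleLattice E := by
  classical
  have hden : ∀ z : Loc E, ∃ n : ℕ, ∃ x : E, (X : ℂ⟦X⟧) ^ n • z = LocalizedModule.mk x 1 := by
    intro z
    induction z using LocalizedModule.induction_on with
    | _ x s =>
      obtain ⟨_, n, rfl⟩ := s
      refine ⟨n, x, ?_⟩
      rw [LocalizedModule.smul'_mk]
      exact LocalizedModule.mk_cancel (⟨X ^ n, n, rfl⟩ : Submonoid.powers (X : ℂ⟦X⟧)) x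
  choose n hn using hden
  let ι : E →ₗ[ℂ⟦X⟧] Loc E := LocalizedModule.mkLinearMap _ E
  obtain ⟨s, hs⟩ := hE
  let k := s.sup n
  have hk : ∀ z ∈ saturation E, ∃ x : E, (X : ℂ⟦X⟧) ^ k • z = LocalizedModule.mk x 1 := by
    have hle : saturation E ≤
        (LinearMap.range ι).comap (LinearMap.lsmul ℂ⟦X⟧ (Loc E) (X ^ k)) := by
      rw [← hs, Submodule.span_le]
      intro z hz
      obtain ⟨x, hx⟩ := hn z
      refine ⟨(X : ℂ⟦X⟧) ^ (k - n z) • x, ?_⟩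
      have hkn : k - n z + n z = k := Nat.sub_add_cancel (Finset.le_sup (f := n) hz)
      have hz' : (X : ℂ⟦X⟧) ^ k • z = (X : ℂ⟦X⟧) ^ (k - n z) • (X : ℂ⟦X⟧) ^ n z • z := by
        rw [← mul_smul, ← pow_add, hkn]
      rw [map_smul, LinearMap.lsmul_apply, hz', hx]
      rfl
    intro z hz
    obtain ⟨x, hx⟩ := hle hz
    exact ⟨x, hx.symm⟩
  have hmem : ∀ x : E, x ∈ ((saturation E).map (LinearMap.lsmul ℂ⟦X⟧ (Loc E) (X ^ k))).comap ι ↔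
      ∃ z ∈ saturation E, (X : ℂ⟦X⟧) ^ k • z = LocalizedModule.mk x 1 := fun x => Iff.rfl
  refine ⟨((saturation E).map (LinearMap.lsmul ℂ⟦X⟧ (Loc E) (X ^ k))).comap ι, k,
    fun x => (hmem _).2 ⟨LocalizedModule.mk x 1, saturation_contains x,
      LocalizedModule.smul'_mk _ _ _⟩, fun x hx => ?_⟩
  obtain ⟨z, hz, hzx⟩ := (hmem x).1 hx
  -- `b⁻¹ a (b ^ k z) = b ^ k (b⁻¹ a z + k z)`, so stability survives multiplication by `b ^ k`.
  have hw : bInvA E z + k • z ∈ saturation E :=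
    add_mem (saturation_stable hz) (nsmul_mem hz k)
  obtain ⟨y, hy⟩ := hk _ hw
  refine ⟨y, (hmem y).2 ⟨_, hw, hy⟩, mk_one_injective ?_⟩
  simp only
  rw [← LocalizedModule.smul'_mk, ← hy, ← bInvA_X_pow_smul, hzx, bInvA_mk_one]

theorem HasSimplePoleLattice.of_surjective (hE : HasSimplePoleLattice E) {p : E →ₗ[ℂ⟦X⟧] F}
    (hp : IsMorphism p) (hs : Function.Surjective p) : HasSimplePoleLattice F := by
  obtain ⟨M, k, hk, ha⟩ := hE
  refine ⟨M.map p, k, fun y => ?_, ?_⟩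
  · obtain ⟨x, rfl⟩ := hs y
    exact ⟨_, hk x, map_smul _ _ _⟩
  · rintro _ ⟨x, hx, rfl⟩
    obtain ⟨y, hy, hxy⟩ := ha x hx
    exact ⟨p y, ⟨y, hy, rfl⟩, by rw [← hp, hxy, map_smul]⟩

/-- The operator `b⁻¹ a` on a simple pole lattice. -/
theorem exists_theta {M : Submodule ℂ⟦X⟧ E} (ha : ∀ x ∈ M, ∃ y ∈ M, a x = (X : ℂ⟦X⟧) • y) :
    ∃ θ : M →ₗ[ℂ] M, (∀ x : M, a (x : E) = (X : ℂ⟦X⟧) • (θ x : E)) ∧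
      ∀ x : M, θ ((X : ℂ⟦X⟧) • x) = (X : ℂ⟦X⟧) • θ x + (X : ℂ⟦X⟧) • x := by
  choose t htM ht using ha
  let θ : M →ₗ[ℂ] M :=
    { toFun := fun x => ⟨t x x.2, htM x x.2⟩
      map_add' := fun x y => Subtype.ext <| X_smul_cancel <| by
        change X • t (x + y : M) _ = (X : ℂ⟦X⟧) • (t x _ + t y _)
        rw [← ht, smul_add, ← ht, ← ht, Submodule.coe_add, map_add]
      map_smul' := fun c x => Subtype.ext <| X_smul_cancel <| by
        change X • t (c • x : M) _ = (X : ℂ⟦X⟧) • c • t x _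
        rw [← ht, smul_comm_complex, ← ht, ← map_smul]
        rfl }
  have hθ : ∀ x : M, a (x : E) = (X : ℂ⟦X⟧) • (θ x : E) := fun x => ht x x.2
  refine ⟨θ, hθ, fun x => Subtype.ext <| X_smul_cancel ?_⟩
  rw [← hθ, Submodule.coe_smul, a_X_smul, hθ, Submodule.coe_add, Submodule.coe_smul,
    Submodule.coe_smul, smul_add, pow_two, mul_smul]

theorem HasSimplePoleLattice.exists_eigenvector [Nontrivial E] (hE : HasSimplePoleLattice E) :
    ∃ (l : ℂ) (e : E), e ≠ 0 ∧ a e = l • (X : ℂ⟦X⟧) • e := by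
  obtain ⟨M, k, hk, ha⟩ := hE
  obtain ⟨θ, hθ, hX⟩ := exists_theta ha
  have : Nontrivial M := by
    obtain ⟨x, hx⟩ := exists_ne (0 : E)
    exact ⟨⟨⟨_, hk x⟩, 0, fun h => smul_ne_zero (pow_ne_zero k X_ne_zero) hx
      (congrArg Subtype.val h)⟩⟩
  obtain ⟨l, e, he, h⟩ := ABModule.exists_eigenvector θ hX
  refine ⟨l, e, fun h => he (Subtype.ext h), ?_⟩
  rw [hθ, h, ← smul_comm_complex]
  rfl

/-- The exponents of morphisms from and to rank one modules are bounded. -/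
theorem HasSimplePoleLattice.exists_bound (hE : HasSimplePoleLattice E) :
    ∃ B : ℝ, (∀ (l : ℂ) (e : E), e ≠ 0 → a e = l • (X : ℂ⟦X⟧) • e → -B ≤ l.re) ∧
      ∀ (l : ℂ) (f : E →ₗ[ℂ⟦X⟧] RankOne l), IsMorphism f → f ≠ 0 → l.re ≤ B := by
  classical
  obtain ⟨M, k, hk, ha⟩ := hE
  obtain ⟨θ, hθ, hX⟩ := exists_theta ha
  obtain ⟨σ, -, -, hσ⟩ := exists_indicial_finset θ hX
  obtain ⟨B, hB⟩ := (σ.image fun μ => |μ.re|).exists_le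
  have hB' : ∀ μ ∈ σ, |μ.re| ≤ B := fun μ hμ => hB _ (Finset.mem_image_of_mem _ hμ)
  have hk0 : (0 : ℝ) ≤ k := Nat.cast_nonneg k
  refine ⟨B + k, fun l e he0 he => ?_, fun l f hf hf0 => ?_⟩
  · have hne : (⟨_, hk e⟩ : M) ≠ 0 :=
      fun h => smul_ne_zero (pow_ne_zero k X_ne_zero) he0 (congrArg Subtype.val h)
    obtain ⟨m, y, hy, hydiv⟩ := exists_eq_X_pow_smul (K := ℂ) hne
    have hy' : (X : ℂ⟦X⟧) ^ k • e = (X : ℂ⟦X⟧) ^ m • (y : E) := congrArg Subtype.val hy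
    have h1 := a_X_pow_smul k e
    rw [hy', a_X_pow_smul, he, ← add_smul, smul_comm_complex, smul_comm (X ^ k : ℂ⟦X⟧) X e, hy',
      smul_comm X (X ^ m : ℂ⟦X⟧), ← smul_comm_complex (l + k) (X ^ m)] at h1
    have h2 := X_pow_smul_cancel m h1
    -- Multiplying by `b ^ k` raises the exponent by `k`, dividing by `b ^ m` lowers it by `m`.
    -- Since `y` is nonzero modulo `X`, `l + k - m` must lie in `σ`.
    have h3 : θ y = (l + k - m) • y + (X : ℂ⟦X⟧) • (0 : M) := by
      rw [smul_zero, add_zero]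
      refine Subtype.ext (X_smul_cancel ?_)
      rw [← hθ, eq_sub_of_add_eq h2, ← sub_smul, ← smul_comm_complex]
      rfl
    by_contra hlt
    push Not at hlt
    obtain ⟨z, hz⟩ := (hσ (l + k - m) fun hmem => by
      have := (abs_le.1 (hB' _ hmem)).1
      have hm0 : (0 : ℝ) ≤ m := Nat.cast_nonneg m
      simp only [Complex.sub_re, Complex.add_re, Complex.natCast_re] at this
      linarith).2 y 0 h3
    exact hydiv z hz
  · let φ : E → ℂ⟦X⟧ := f
    have hφX : ∀ x, φ ((X : ℂ⟦X⟧) • x) = X * φ x := fun x => f.map_smul _ _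
    have hφθ : ∀ y : M, φ (θ y) = C l * φ y + X * derivative ℂ (φ y) := by
      intro y
      refine X_mul_cancel ?_
      rw [← hφX, ← hθ]
      refine (hf y).trans ?_
      change l • (X * φ y) + X ^ 2 * derivative ℂ (φ y) = _
      rw [smul_eq_C_mul]
      ring
    -- Let `m` be the least order of `φ` on `M`. If `l + m` were outside `σ`, every `x` would be `θ
    -- y - (l + m) y + X z`, and both parts have zero coefficient of index `m` under `φ`: the first
    -- by `hφθ`, the second by minimality of `m`.
    have hex : ∃ m : ℕ, ∃ x : M, coeff m (φ x) ≠ 0 := by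
      by_contra! h
      refine hf0 (LinearMap.ext fun x => ?_)
      have h1 : φ ((X : ℂ⟦X⟧) ^ k • x) = 0 := PowerSeries.ext fun n => h n ⟨_, hk x⟩
      have h2 : φ ((X : ℂ⟦X⟧) ^ k • x) = X ^ k * φ x := f.map_smul _ _
      rw [h2] at h1
      exact (mul_eq_zero.1 h1).resolve_left (pow_ne_zero k X_ne_zero)
    obtain ⟨x, hx⟩ := Nat.find_spec hex
    set m := Nat.find hex with hm
    by_contra hlt
    push Not at hlt
    obtain ⟨y, z, hyz⟩ := (hσ (l + m) fun hmem => by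
      have := (abs_le.1 (hB' _ hmem)).2
      have hm0 : (0 : ℝ) ≤ m := Nat.cast_nonneg m
      simp only [Complex.add_re, Complex.natCast_re] at this
      linarith).1 x
    have hz : coeff m (X * φ z) = 0 := by
      rcases Nat.eq_zero_or_pos m with h0 | hpos
      · rw [h0]; simp
      · obtain ⟨j, hj⟩ := Nat.exists_eq_succ_of_ne_zero hpos.ne'
        rw [hj, Nat.succ_eq_add_one, coeff_succ_X_mul]
        by_contra h
        exact Nat.find_min hex (m := j) (by omega) ⟨z, h⟩
    have hd : coeff m (X * derivative ℂ (φ y)) = m * coeff m (φ y) := by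
      cases m with
      | zero => simp
      | succ n => rw [coeff_succ_X_mul, coeff_derivative]; push_cast; ring
    have hφ : φ x = φ (θ y) - C (l + m) * φ y + X * φ z := by
      rw [hyz, ← hφX]
      have h1 : φ ((l + m : ℂ) • (y : E)) = C (l + m) * φ y := by
        rw [← C_smul]
        exact f.map_smul _ _
      rw [← h1]
      exact (f.map_add _ _).trans (congrArg (· + _) (f.map_sub _ _))
    refine hx ?_
    rw [hφ, hφθ, map_add, map_sub, map_add, hz, hd, coeff_C_mul, coeff_C_mul]
    ring

end Lattice

/-! ### Quotient by a minimal rank one submodule. -/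

section Quotient

open PowerSeries

variable {E : Type*} [AddCommGroup E] [Module ℂ E] [Module ℂ⟦X⟧ E] [IsScalarTower ℂ ℂ⟦X⟧ E]
  [ABModule E]

/-- The `ℂ`-linear map that `a` induces on the quotient by a stable submodule. -/
noncomputable def quotientMap (N : Submodule ℂ⟦X⟧ E) (hN : ∀ x ∈ N, a x ∈ N) :
    (E ⧸ N) →ₗ[ℂ] E ⧸ N :=
  (Submodule.Quotient.restrictScalarsEquiv ℂ N).toLinearMap ∘ₗ
    (N.restrictScalars ℂ).mapQ (N.restrictScalars ℂ) a hN ∘ₗ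
      (Submodule.Quotient.restrictScalarsEquiv ℂ N).symm.toLinearMap

theorem quotientMap_mk (N : Submodule ℂ⟦X⟧ E) (hN : ∀ x ∈ N, a x ∈ N) (x : E) :
    quotientMap N hN (Submodule.Quotient.mk x) = Submodule.Quotient.mk (a x) := rfl

/-- The quotient (a,b)-module by a stable submodule with free quotient. -/
@[reducible]
noncomputable def quotientABModule (N : Submodule ℂ⟦X⟧ E) (hN : ∀ x ∈ N, a x ∈ N)
    (hfree : Module.Free ℂ⟦X⟧ (E ⧸ N)) : ABModule (E ⧸ N) :=
  have hcomm : ∀ x : E ⧸ N, quotientMap N hN ((X : ℂ⟦X⟧) • x) - (X : ℂ⟦X⟧) • quotientMap N hN x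
      = (X : ℂ⟦X⟧) ^ 2 • x := by
    intro x
    obtain ⟨x, rfl⟩ := Submodule.Quotient.mk_surjective _ x
    rw [← Submodule.Quotient.mk_smul, quotientMap_mk, quotientMap_mk, ← Submodule.Quotient.mk_smul,
      ← Submodule.Quotient.mk_sub, comm_a, Submodule.Quotient.mk_smul]
  { free := hfree
    finite := inferInstance
    a := quotientMap N hN
    continuous_a := continuous_of_comm (quotientMap N hN).toAddMonoidHom hcomm
    comm_a := hcomm }

/-- The image of `E_l` in `E` is saturated when `l` is minimal in its class. -/
theorem mem_range_of_X_smul_mem {l : ℂ}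
    (hl : ((l.re : ℝ) : EReal) = lambdaMin E (QuotientAddGroup.mk l : CModZ))
    {i : RankOne l →ₗ[ℂ⟦X⟧] E} (hi : IsMorphism i) (h0 : i ≠ 0) {x : E}
    (hx : (X : ℂ⟦X⟧) • x ∈ LinearMap.range i) : x ∈ LinearMap.range i := by
  obtain ⟨S, hS⟩ := hx
  rw [RankOne.eq_smul_gen S, map_smul] at hS
  set S' : ℂ⟦X⟧ := S
  -- If `S'` is a unit, the image of the generator is `b y`, and `y` has exponent `l - 1`, against
  -- the minimality of `l`.
  by_cases hc : constantCoeff S' = 0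
  · obtain ⟨T, hT⟩ := X_dvd_iff.2 hc
    refine ⟨T • RankOne.gen l, ?_⟩
    rw [hT, mul_smul] at hS
    rw [map_smul]
    exact X_smul_cancel hS
  · exfalso
    obtain ⟨u, hu⟩ := (isUnit_iff_constantCoeff (φ := S')).2 (isUnit_iff_ne_zero.2 hc)
    have he : i (RankOne.gen l) = (X : ℂ⟦X⟧) • ((u⁻¹ : ℂ⟦X⟧ˣ) : ℂ⟦X⟧) • x := by
      rw [smul_comm, ← hS, ← mul_smul, ← hu, Units.inv_mul, one_smul]
    set y : E := ((u⁻¹ : ℂ⟦X⟧ˣ) : ℂ⟦X⟧) • x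
    have hae := hi.a_gen
    rw [he, a_X_smul, ← smul_comm_complex, pow_two, mul_smul, ← smul_add] at hae
    have hy : a y = (l - 1) • (X : ℂ⟦X⟧) • y := by
      rw [sub_smul, one_smul]
      exact eq_sub_of_add_eq (X_smul_cancel hae)
    have hy0 : y ≠ 0 := fun h => gen_ne_zero_of_ne_zero h0 (by rw [he, h, smul_zero])
    have hle : lambdaMin E (QuotientAddGroup.mk l : CModZ) ≤ (((l - 1).re : ℝ) : EReal) := by
      rw [lambdaMin_eq]
      refine iInf₂_le (l - 1) ⟨?_, y, hy0, hy⟩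
      rw [QuotientAddGroup.eq]
      exact ⟨1, by simp⟩
    rw [← hl, EReal.coe_le_coe_iff, Complex.sub_re, Complex.one_re] at hle
    linarith

/-- A nonzero series is a unit times a power of `X`, so the hypothesis excludes all torsion, and a
finite torsion-free module over a principal ideal domain is free. -/
theorem free_quotient {N : Submodule ℂ⟦X⟧ E} (h : ∀ x : E, (X : ℂ⟦X⟧) • x ∈ N → x ∈ N) :
    Module.Free ℂ⟦X⟧ (E ⧸ N) := by
  have hpow : ∀ (n : ℕ) (x : E), (X : ℂ⟦X⟧) ^ n • x ∈ N → x ∈ N := by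
    intro n
    induction n with
    | zero => intro x hx; simpa using hx
    | succ n ih => exact fun x hx => h x (ih _ (by rwa [← mul_smul, ← pow_succ]))
  have : Module.IsTorsionFree ℂ⟦X⟧ (E ⧸ N) := by
    rw [Module.isTorsionFree_iff_smul_eq_zero]
    intro r x hrx
    rw [or_iff_not_imp_left]
    intro hr
    obtain ⟨x, rfl⟩ := Submodule.Quotient.mk_surjective _ x
    obtain ⟨n, u, rfl⟩ := IsDiscreteValuationRing.eq_unit_mul_pow_irreducible hr
      (X_irreducible (R := ℂ))
    rw [← Submodule.Quotient.mk_smul, Submodule.Quotient.mk_eq_zero, mul_smul] at hrx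
    rw [Submodule.Quotient.mk_eq_zero]
    exact hpow n x ((Submodule.smul_mem_iff_of_isUnit N u.isUnit).1 hrx)
  exact Module.free_of_finite_type_torsion_free'

end Quotient

/-! ### Integrality and lower bound of the width. -/

section Width

open PowerSeries

universe u

theorem exists_int_add_of_mk_eq {l m : ℂ}
    (h : (QuotientAddGroup.mk l : CModZ) = QuotientAddGroup.mk m) : ∃ k : ℤ, m = l + k := by
  rw [QuotientAddGroup.eq] at h
  obtain ⟨k, hk⟩ := h
  refine ⟨k, ?_⟩
  simp only [zsmul_eq_mul, mul_one] at hk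
  rw [hk]; ring

/-- A nonempty subset of a class modulo `ℤ` with real parts bounded below attains its minimum. -/
theorem exists_re_min {S : Set ℂ} {c : CModZ} (hS : ∀ l ∈ S, (QuotientAddGroup.mk l : CModZ) = c)
    {B : ℝ} (hB : ∀ l ∈ S, B ≤ l.re) (hne : S.Nonempty) : ∃ l ∈ S, ∀ m ∈ S, l.re ≤ m.re := by
  obtain ⟨l₀, h₀⟩ := hne
  obtain ⟨k, hk, hmin⟩ := Int.exists_least_of_bdd (P := fun k : ℤ => l₀ + k ∈ S)
    ⟨⌊B - l₀.re⌋, fun z hz => by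
      have h1 := hB _ hz
      rw [Complex.add_re, Complex.intCast_re] at h1
      have h2 := Int.floor_le (B - l₀.re)
      exact_mod_cast (by linarith : (⌊B - l₀.re⌋ : ℝ) ≤ z)⟩ ⟨0, by simpa using h₀⟩
  refine ⟨_, hk, fun m hm => ?_⟩
  obtain ⟨j, rfl⟩ := exists_int_add_of_mk_eq ((hS _ h₀).trans (hS _ hm).symm)
  simpa using hmin j hm

/-- A nonempty subset of a class modulo `ℤ` with real parts bounded above attains its maximum. -/
theorem exists_re_max {S : Set ℂ} {c : CModZ} (hS : ∀ l ∈ S, (QuotientAddGroup.mk l : CModZ) = c)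
    {B : ℝ} (hB : ∀ l ∈ S, l.re ≤ B) (hne : S.Nonempty) : ∃ l ∈ S, ∀ m ∈ S, m.re ≤ l.re := by
  obtain ⟨l, hl, h⟩ := exists_re_min (S := -S) (c := -c) (B := -B)
    (fun l hl => by rw [← hS _ hl, QuotientAddGroup.mk_neg, neg_neg])
    (fun l hl => by simpa [neg_le] using hB _ hl) hne.neg
  exact ⟨-l, hl, fun m hm => by simpa [le_neg] using h (-m) (by simpa using hm)⟩

section

variable {E : Type*} [AddCommGroup E] [Module ℂ E] [Module ℂ⟦X⟧ E] [IsScalarTower ℂ ℂ⟦X⟧ E]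
  [ABModule E]

theorem HasSimplePoleLattice.exists_lambdaMin_eq (hE : HasSimplePoleLattice E) {c : CModZ}
    (hne : (minSet E c).Nonempty) : ∃ l ∈ minSet E c, lambdaMin E c = ((l.re : ℝ) : EReal) := by
  obtain ⟨B, hB, -⟩ := hE.exists_bound
  obtain ⟨l, hl, h⟩ := exists_re_min (fun l (hl : l ∈ minSet E c) => hl.1)
    (fun l ⟨_, e, he0, he⟩ => hB l e he0 he) hne
  refine ⟨l, hl, ?_⟩
  rw [lambdaMin_eq]
  exact le_antisymm (iInf₂_le l hl) (le_iInf₂ fun m hm => EReal.coe_le_coe_iff.2 (h m hm))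

theorem HasSimplePoleLattice.exists_lambdaMax_eq (hE : HasSimplePoleLattice E) {c : CModZ}
    (hne : (maxSet E c).Nonempty) : ∃ l ∈ maxSet E c, lambdaMax E c = ((l.re : ℝ) : EReal) := by
  obtain ⟨B, -, hB⟩ := hE.exists_bound
  obtain ⟨l, hl, h⟩ := exists_re_max (fun l (hl : l ∈ maxSet E c) => hl.1)
    (fun l ⟨_, f, hf, hf0⟩ => hB l f hf hf0) hne
  refine ⟨l, hl, ?_⟩
  rw [lambdaMax_eq]
  exact le_antisymm (iSup₂_le fun m hm => EReal.coe_le_coe_iff.2 (h m hm))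
    (le_iSup₂ (f := fun (l : ℂ) (_ : l ∈ maxSet E c) => ((l.re : ℝ) : EReal)) l hl)

/-- The width of `E` in each class is `-∞` or an integer, with a uniform bound. -/
theorem HasSimplePoleLattice.widthAt_eq (hE : HasSimplePoleLattice E) :
    ∃ N : ℤ, ∀ c : CModZ, widthAt E c = ⊥ ∨ ∃ k : ℤ, widthAt E c = ((k : ℝ) : EReal) ∧ k ≤ N := by
  obtain ⟨B, hB1, hB2⟩ := hE.exists_bound
  refine ⟨⌈2 * B⌉, fun c => ?_⟩
  rcases (maxSet E c).eq_empty_or_nonempty with h | hmax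
  · left
    simp [widthAt, lambdaMax_eq, h, sub_eq_add_neg]
  rcases (minSet E c).eq_empty_or_nonempty with h | hmin
  · left
    simp [widthAt, lambdaMin_eq, h, sub_eq_add_neg]
  right
  obtain ⟨l, ⟨hl, e, he0, he⟩, hlmin⟩ := hE.exists_lambdaMin_eq hmin
  obtain ⟨m, ⟨hm, f, hf, hf0⟩, hmmax⟩ := hE.exists_lambdaMax_eq hmax
  obtain ⟨k, rfl⟩ := exists_int_add_of_mk_eq (hl.trans hm.symm)
  have h1 := hB1 l e he0 he
  have h2 := hB2 _ f hf hf0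
  rw [Complex.add_re, Complex.intCast_re] at h2
  refine ⟨k, ?_, ?_⟩
  · rw [widthAt, hlmin, hmmax, ← EReal.coe_sub]
    simp
  · have h3 := Int.le_ceil (2 * B)
    exact_mod_cast (by linarith : (k : ℝ) ≤ ⌈2 * B⌉)

theorem HasSimplePoleLattice.exists_minimal_embedding [Nontrivial E]
    (hE : HasSimplePoleLattice E) : ∃ l : ℂ,
      ((l.re : ℝ) : EReal) = lambdaMin E (QuotientAddGroup.mk l : CModZ) ∧
        ∃ i : RankOne l →ₗ[ℂ⟦X⟧] E, IsMorphism i ∧ i ≠ 0 := by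
  obtain ⟨l', e', he0', he'⟩ := hE.exists_eigenvector
  obtain ⟨l, ⟨hl, he⟩, hlmin⟩ := hE.exists_lambdaMin_eq
    (c := QuotientAddGroup.mk l') ⟨l', rfl, e', he0', he'⟩
  exact ⟨l, by rw [hl, hlmin], exists_morphism_iff.2 he⟩

/-- The inverse of `i` is a morphism `E → E_l`, so the maximum in the class of `l` is at least the
minimum `l`. -/
theorem zero_le_width_of_surjective {l : ℂ}
    (hl : ((l.re : ℝ) : EReal) = lambdaMin E (QuotientAddGroup.mk l : CModZ))
    {i : RankOne l →ₗ[ℂ⟦X⟧] E} (hi : IsMorphism i) (h0 : i ≠ 0) (hs : Function.Surjective i) :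
    0 ≤ width E := by
  let g := (LinearEquiv.ofBijective i ⟨injective_of_ne_zero h0, hs⟩).symm
  have hig : ∀ x, i (g x) = x :=
    (LinearEquiv.ofBijective i ⟨injective_of_ne_zero h0, hs⟩).apply_symm_apply
  have hg : IsMorphism g.toLinearMap := fun x => injective_of_ne_zero h0 <| by
    change i (g (a x)) = i (a (g x))
    rw [hi, hig, hig]
  have hg0 : g.toLinearMap ≠ 0 := fun h => gen_ne_zero_of_ne_zero h0 <| by
    rw [← hig (i (RankOne.gen l))]
    exact (congrArg i (LinearMap.congr_fun h _)).trans (map_zero i)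
  have hle : ((l.re : ℝ) : EReal) ≤ lambdaMax E (QuotientAddGroup.mk l : CModZ) := by
    rw [lambdaMax_eq]
    exact le_iSup₂ (f := fun (l' : ℂ) (_ : l' ∈ maxSet E (QuotientAddGroup.mk l)) =>
      ((l'.re : ℝ) : EReal)) l ⟨rfl, _, hg, hg0⟩
  refine le_trans ?_ (le_iSup (widthAt E) (QuotientAddGroup.mk l))
  rw [widthAt, ← hl]
  exact (EReal.sub_nonneg (.inr (EReal.coe_ne_top _)) (.inr (EReal.coe_ne_bot _))).2 hle

end

/-- The lower bound for the width, by induction on the rank. -/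
theorem HasSimplePoleLattice.one_le_width_add (n : ℕ) : ∀ (E : Type u) [AddCommGroup E]
    [Module ℂ E] [Module ℂ⟦X⟧ E] [IsScalarTower ℂ ℂ⟦X⟧ E] [ABModule E],
    HasSimplePoleLattice E → Module.finrank ℂ⟦X⟧ E = n + 1 →
      1 ≤ width E + (Module.finrank ℂ⟦X⟧ E : EReal) := by
  induction n with
  | zero =>
    intro E _ _ _ _ _ hE hn
    have : Nontrivial E := Module.nontrivial_of_finrank_pos (R := ℂ⟦X⟧) (by omega)
    obtain ⟨l, hl, i, hi, hi0⟩ := hE.exists_minimal_embedding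
    have hfree := free_quotient fun x => mem_range_of_X_smul_mem hl hi hi0 (x := x)
    have hrank := finrank_eq_of_exact (injective_of_ne_zero hi0)
      (LinearMap.exact_map_mkQ_range i) (Submodule.mkQ_surjective _)
    have hsub : Subsingleton (E ⧸ LinearMap.range i) :=
      Module.finrank_zero_iff.1 (by omega : Module.finrank ℂ⟦X⟧ (E ⧸ LinearMap.range i) = 0)
    rw [Submodule.Quotient.subsingleton_iff, LinearMap.range_eq_top] at hsub
    rw [hn]
    simpa using add_le_add_left (zero_le_width_of_surjective hl hi hi0 hsub) (1 : EReal)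
  | succ n ih =>
    intro E _ _ _ _ _ hE hn
    have : Nontrivial E := Module.nontrivial_of_finrank_pos (R := ℂ⟦X⟧) (by omega)
    obtain ⟨l, hl, i, hi, hi0⟩ := hE.exists_minimal_embedding
    have hfree := free_quotient fun x => mem_range_of_X_smul_mem hl hi hi0 (x := x)
    let := quotientABModule (LinearMap.range i)
      (by rintro _ ⟨S, rfl⟩; exact ⟨a S, hi S⟩) hfree
    have hp : IsMorphism (LinearMap.range i).mkQ := fun x => rfl
    have hps := (LinearMap.range i).mkQ_surjective
    have hex := LinearMap.exact_map_mkQ_range i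
    have hinj := injective_of_ne_zero hi0
    have hrank := finrank_eq_of_exact hinj hex hps
    exact (ih _ (hE.of_surjective hp hps) (by omega)).trans
      (width_add_finrank_le_of_exact hl hi hp hinj hex hps)

theorem HasSimplePoleLattice.exists_int_width_eq {E : Type u} [AddCommGroup E] [Module ℂ E]
    [Module ℂ⟦X⟧ E] [IsScalarTower ℂ ℂ⟦X⟧ E] [ABModule E] [Nontrivial E]
    (hE : HasSimplePoleLattice E) : ∃ n : ℤ, 1 ≤ n ∧
      width E + (Module.finrank ℂ⟦X⟧ E : EReal) = ((n : ℝ) : EReal) := by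
  have hpos : 0 < Module.finrank ℂ⟦X⟧ E := Module.finrank_pos
  have hle := HasSimplePoleLattice.one_le_width_add (Module.finrank ℂ⟦X⟧ E - 1) E hE (by omega)
  obtain ⟨N, hN⟩ := hE.widthAt_eq
  obtain ⟨k, ⟨c, hc⟩, hk⟩ := Int.exists_greatest_of_bdd
    (P := fun k : ℤ => ∃ c : CModZ, widthAt E c = ((k : ℝ) : EReal))
    ⟨N, fun z ⟨c, hz⟩ => by
      rcases hN c with h | ⟨j, hj, hjN⟩
      · rw [h] at hz
        exact absurd hz.symm (EReal.coe_ne_bot _)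
      · rw [hj, EReal.coe_eq_coe_iff, Int.cast_inj] at hz
        exact hz ▸ hjN⟩
    (by
      -- If every class had width `-∞`, the sum with the rank would be `-∞`, contradicting the lower
      -- bound 1.
      by_contra! h
      have hbot : width E = ⊥ := by
        refine le_bot_iff.1 (iSup_le fun c => ?_)
        rcases hN c with h' | ⟨j, hj, -⟩
        · exact h'.le
        · exact absurd hj (h j c)
      rw [hbot, EReal.bot_add, le_bot_iff] at hle
      exact EReal.coe_ne_bot 1 hle)
  have hw : width E = ((k : ℝ) : EReal) := by
    refine le_antisymm (iSup_le fun c' => ?_) (hc ▸ le_iSup (widthAt E) c)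
    rcases hN c' with h | ⟨j, hj, -⟩
    · exact h ▸ bot_le
    · rw [hj, EReal.coe_le_coe_iff, Int.cast_le]
      exact hk j ⟨c', hj⟩
  have hsum : width E + (Module.finrank ℂ⟦X⟧ E : EReal)
      = (((k + Module.finrank ℂ⟦X⟧ E : ℤ) : ℝ) : EReal) := by
    rw [hw]
    push_cast
    rfl
  refine ⟨_, ?_, hsum⟩
  rw [hsum] at hle
  exact_mod_cast (EReal.coe_le_coe_iff.1 hle : (1 : ℝ) ≤ _)

end Width

end ABModule

theorem mainTheorem6 {E : Type*} [AddCommGroup E] [Module ℂ E] [Module ℂ⟦X⟧ E]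
    [IsScalarTower ℂ ℂ⟦X⟧ E] [ABModule E] (hE : ABModule.IsRegular E) :
    (∀ (l : ℂ), ((l.re : ℝ) : EReal)
        = ABModule.lambdaMin E (QuotientAddGroup.mk l : ABModule.CModZ) →
      ∀ (F : Type*) [AddCommGroup F] [Module ℂ F] [Module ℂ⟦X⟧ F]
        [IsScalarTower ℂ ℂ⟦X⟧ F] [ABModule F]
        (i : ABModule.RankOne l →ₗ[ℂ⟦X⟧] E) (p : E →ₗ[ℂ⟦X⟧] F),
        ABModule.IsMorphism i → ABModule.IsMorphism p →
        Function.Injective i → Function.Exact i p → Function.Surjective p →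
          (∀ c : ABModule.CModZ, ABModule.widthAt F c ≤ ABModule.widthAt E c + 1) ∧
          ABModule.width F + (Module.finrank ℂ⟦X⟧ F : EReal)
            ≤ ABModule.width E + (Module.finrank ℂ⟦X⟧ E : EReal)) ∧
    (Nontrivial E → ∃ n : ℤ, 1 ≤ n ∧
      ABModule.width E + (Module.finrank ℂ⟦X⟧ E : EReal) = ((n : ℝ) : EReal)) := by
  refine ⟨fun l hl F _ _ _ _ _ i p hi hp hinj hex hs =>
    ⟨ABModule.widthAt_le_of_exact hl hi hp hex hs,
      ABModule.width_add_finrank_le_of_exact hl hi hp hinj hex hs⟩, fun _ => ?_⟩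
  exact hE.hasSimplePoleLattice.exists_int_width_eq
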